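/- Let $\xi\in\mathbb C[[x]]$ be a power series with $\xi(0)=0$ and let $t\ge 1$ be a real number. The quasimonomial valuation $v(\xi,t)$ on $\mathbb C[x,y]$ is defined by $v(\xi,t)(f)=\operatorname{ord}_x f\bigl(x,\xi(x)+\theta x^t\bigr)$, where $\theta$ is transcendental over $\mathbb C$. For a valuation $v\colon\mathbb C[x,y]\to[0,\infty]$, finite on nonzero polynomials, put $$\mu_d(v)=\max\{v(f) : 0\ne f\in\mathbb C[x,y],\ \deg f\le d\},\qquad \hat\mu(v)=\lim_{d\to\infty}\frac{\mu_d(v)}{d},$$ $$\operatorname{vol}(v)=\lim_{m\to\infty}\frac{\dim_{\mathbb C}\mathbb C[x,y]/I_m}{m^2/2},\qquad I_m=\{f\in\mathbb C[x,y] : v(f)\ge m\}\quad(m\in\mathbb R),$$ whenever these exist. Call $v$ minimal if $\hat\mu(v)$ and $\operatorname{vol}(v)$ exist, $\operatorname{vol}(v)>0$, and $\hat\mu(v)=\sqrt{1/\operatorname{vol}(v)}$. For fixed $t$ and $k=\lceil t\rceil$, a property holds for very general $\xi=\sum_{i\ge1} a_i x^i$ if there are countably many proper Zariski-closed subsets of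 the space $\mathbb A^{k-1}_{\mathbb C}$ of $(k-1)$-jets such that it holds for every $\xi$ with $\xi(0)=0$ whose jet $(a_1,\dots,a_{k-1})$ lies in none of them. Proposition. Let $t\ge 1$ be the square of an integer. Then for very general $\xi$ the valuation $v(\xi,t)$ is minimal. Moreover $\hat\mu(t)=\sqrt t$, that is: $\hat\mu(v(\xi,t))$ exists and equals $\sqrt t$ for very general $\xi$, and $\hat\mu(v(\xi,t))\ge\sqrt t$ for every $\xi$ with $\xi(0)=0$ for which $\hat\mu(v(\xi,t))$ exists. -/

import Mathlib

open Filter Topology Polynomial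

noncomputable section

namespace QuasimonomialValuation

/-- The coordinate ring `ℂ[x, y]` of the affine plane; `x = X 0` and `y = X 1`. -/
abbrev PlaneRing : Type := MvPolynomial (Fin 2) ℂ

/-- A power series `ξ(x) ∈ ℂ⟦x⟧`, viewed as a generalized power series in `x` with real exponents
and with coefficients in `ℂ[θ]`. -/
def seriesToHahn (ξ : PowerSeries ℂ) : HahnSeries ℝ ℂ[X] :=
  HahnSeries.ofPowerSeries ℝ ℂ[X] (PowerSeries.map Polynomial.C ξ)

/-- The substitution `f(x, y) ↦ f(x, ξ(x) + θ x ^ t)`, with values in the ring of generalized power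
series in `x` with real exponents and coefficients in `ℂ[θ]`, `θ` an indeterminate (the variable
`X` of `ℂ[X]`). -/
def substHom (ξ : PowerSeries ℂ) (t : ℝ) : PlaneRing →+* HahnSeries ℝ ℂ[X] :=
  MvPolynomial.eval₂Hom ((HahnSeries.C : ℂ[X] →+* HahnSeries ℝ ℂ[X]).comp Polynomial.C)
    ![HahnSeries.single 1 1, seriesToHahn ξ + HahnSeries.single t Polynomial.X]

/-- The quasimonomial valuation `v(ξ, t)`, that is `f ↦ ord_x f(x, ξ(x) + θ x ^ t)`. -/
def quasimonomial (ξ : PowerSeries ℂ) (t : ℝ) : AddValuation PlaneRing (WithTop ℝ) :=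
  (HahnSeries.addVal ℝ ℂ[X]).comap (substHom ξ t)

/-- `m` is the maximum `μ_d(v)` of the values `v(f)` over nonzero polynomials `f` of degree at
most `d`. -/
def IsMu (v : AddValuation PlaneRing (WithTop ℝ)) (d : ℕ) (m : ℝ) : Prop :=
  IsGreatest {w : WithTop ℝ | ∃ f : PlaneRing, f ≠ 0 ∧ f.totalDegree ≤ d ∧ v f = w}
    (m : WithTop ℝ)

/-- `r = lim_{d → ∞} μ_d(v) / d`, where all the maxima `μ_d(v)` and the limit exist. -/
def IsMuHat (v : AddValuation PlaneRing (WithTop ℝ)) (r : ℝ) : Prop :=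
  ∃ μ : ℕ → ℝ, (∀ d, IsMu v d (μ d)) ∧ Tendsto (fun d : ℕ => μ d / d) atTop (𝓝 r)

/-- The valuation ideal `I_m = {f ∈ ℂ[x, y] | v(f) ≥ m}`. When `v` is nonnegative on `ℂ[x, y]` the
set is an ideal already, see `mem_valuationIdeal`. -/
def valuationIdeal (v : AddValuation PlaneRing (WithTop ℝ)) (m : ℝ) : Ideal PlaneRing :=
  Ideal.span {f | (m : WithTop ℝ) ≤ v f}

/-- `V = lim_{m → ∞} dim_ℂ (ℂ[x, y] / I_m) / (m ^ 2 / 2)`, where all these dimensions are finite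
and the limit exists: the volume of `v`. -/
def IsVolume (v : AddValuation PlaneRing (WithTop ℝ)) (V : ℝ) : Prop :=
  (∀ m : ℝ, Module.Finite ℂ (PlaneRing ⧸ valuationIdeal v m)) ∧
    Tendsto (fun m : ℝ => (Module.finrank ℂ (PlaneRing ⧸ valuationIdeal v m) : ℝ) / (m ^ 2 / 2))
      atTop (𝓝 V)

/-- `v` is minimal: `μ̂(v) = √(D² / vol v)`, where `D` is a line in the projective plane, so that
`D² = 1`. -/
def IsMinimal (v : AddValuation PlaneRing (WithTop ℝ)) : Prop :=
  ∃ r V : ℝ, IsMuHat v r ∧ IsVolume v V ∧ 0 < V ∧ r = √(1 / V)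

/-- The `(k - 1)`-jet of a series with zero constant term, as the point `(a₁, …, a_{k-1})` of affine
space. -/
def jet (k : ℕ) (ξ : PowerSeries ℂ) : Fin (k - 1) → ℂ := fun i => PowerSeries.coeff (i + 1) ξ

/-- `Z` is a Zariski-closed subset of affine `n`-space other than the whole space. -/
def IsProperZariskiClosed {n : ℕ} (Z : Set (Fin n → ℂ)) : Prop :=
  (∃ I : Ideal (MvPolynomial (Fin n) ℂ), Z = MvPolynomial.zeroLocus ℂ I) ∧ Z ≠ Set.univ

/-- `P ξ` holds for very general `ξ` (with respect to the exponent `t`): it holds for all series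
`ξ` with `ξ(0) = 0` whose `(⌈t⌉ - 1)`-jet lies outside some countable union of proper
Zariski-closed subsets of the space of jets. -/
def ForVeryGeneral (t : ℝ) (P : PowerSeries ℂ → Prop) : Prop :=
  ∃ Z : ℕ → Set (Fin (⌈t⌉₊ - 1) → ℂ), (∀ n, IsProperZariskiClosed (Z n)) ∧
    ∀ ξ : PowerSeries ℂ, PowerSeries.constantCoeff ξ = 0 → (∀ n, jet ⌈t⌉₊ ξ ∉ Z n) → P ξ

/-- `r = μ̂(t)`: very general series `ξ` give the same value `μ̂(ξ, t) = r`, and it is the least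
value of `μ̂(ξ, t)` over all series `ξ` with `ξ(0) = 0`. -/
def IsGenericMuHat (t r : ℝ) : Prop :=
  ForVeryGeneral t (fun ξ => IsMuHat (quasimonomial ξ t) r) ∧
    ∀ ξ : PowerSeries ℂ, PowerSeries.constantCoeff ξ = 0 →
      ∀ s : ℝ, IsMuHat (quasimonomial ξ t) s → r ≤ s

theorem mem_valuationIdeal {v : AddValuation PlaneRing (WithTop ℝ)} (hv : ∀ f, 0 ≤ v f) (m : ℝ)
    (f : PlaneRing) : f ∈ valuationIdeal v m ↔ (m : WithTop ℝ) ≤ v f := by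
  refine ⟨fun h => ?_, fun h => Ideal.subset_span h⟩
  induction h using Submodule.span_induction with
  | mem x hx => exact hx
  | zero => simp
  | add x y _ _ hx hy => exact AddValuation.map_le_add v hx hy
  | smul a x _ hx =>
    rw [smul_eq_mul, AddValuation.map_mul]
    exact le_add_of_nonneg_of_le (hv a) hx

theorem orderTop_seriesToHahn_nonneg (ξ : PowerSeries ℂ) : 0 ≤ (seriesToHahn ξ).orderTop := by
  by_contra! h
  obtain ⟨g, hg⟩ := WithTop.ne_top_iff_exists.1 (ne_top_of_lt h)
  have h1 := HahnSeries.coeff_orderTop_ne hg.symm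
  rw [seriesToHahn, HahnSeries.ofPowerSeries_apply] at h1
  apply h1
  apply HahnSeries.embDomain_of_notMem_range
  rintro ⟨n, hn⟩
  rw [← hg, ← hn] at h
  have : ((n : ℝ) : WithTop ℝ) < ((0 : ℝ) : WithTop ℝ) := h
  rw [WithTop.coe_lt_coe] at this
  exact absurd this (not_lt.2 n.cast_nonneg)

theorem quasimonomial_nonneg (ξ : PowerSeries ℂ) {t : ℝ} (ht : 0 ≤ t) (f : PlaneRing) :
    0 ≤ quasimonomial ξ t f := by
  have ht' : (0 : WithTop ℝ) ≤ (t : WithTop ℝ) := by exact_mod_cast ht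
  induction f using MvPolynomial.induction_on with
  | C a =>
    change 0 ≤ HahnSeries.addVal ℝ ℂ[X] (substHom ξ t (MvPolynomial.C a))
    rw [HahnSeries.addVal_apply, substHom, MvPolynomial.coe_eval₂Hom, MvPolynomial.eval₂_C]
    exact HahnSeries.orderTop_single_le (a := (0 : ℝ))
  | add p q hp hq => exact AddValuation.map_le_add _ hp hq
  | mul_X p i hp =>
    rw [AddValuation.map_mul]
    refine add_nonneg hp ?_
    change 0 ≤ HahnSeries.addVal ℝ ℂ[X] (substHom ξ t (MvPolynomial.X i))
    rw [substHom, MvPolynomial.coe_eval₂Hom, MvPolynomial.eval₂_X]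
    fin_cases i
    · change 0 ≤ (HahnSeries.single (1 : ℝ) (1 : ℂ[X])).orderTop
      rw [HahnSeries.orderTop_single one_ne_zero]
      exact_mod_cast zero_le_one
    · refine AddValuation.map_le_add _ (orderTop_seriesToHahn_nonneg ξ) ?_
      rw [HahnSeries.addVal_apply]
      exact ht'.trans HahnSeries.orderTop_single_le

end QuasimonomialValuation

end

/-! Write t = T = n². If Q agrees with ξ below order T, then v(ξ,T)(f) is the least weight i + T·j
of a monomial x^i y^j of f(x, y + Q(x)) (`exists_quasimonomial_eq_weight`). Hence I_m has as
colength the number of monomials of weight below m, about m²/(2T), and vol = 1/T for every ξ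
(`isVolume_quasimonomial`).

Lower bound, for every ξ: polynomials of degree ≤ d outnumber the monomials of weight below n(d -
n), so linear algebra gives μ_d ≥ n(d - n) (`le_of_isMu`).

Upper bound: for the single series ξ₀ = x^n, a Bézout argument with the curve y = x^n gives v(f) ≤
n·deg f (`quasimonomial_X_pow_le`). For each d, the bound μ_d ≤ nd says that a matrix with entries
polynomial in the jet of ξ is injective; it holds at ξ₀, hence off a proper closed set
(`exists_isProperZariskiClosed`). Discarding one such set per d leaves very general ξ with n(d - n)
≤ μ_d ≤ nd, so μ̂ = n = √t = √(1/vol). -/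

namespace QuasimonomialValuation

/-! ### The triangular automorphism y ↦ y + Q(x). -/

/-- The substitution `f(x, y) ↦ f(x, y + Q(x))`. -/
noncomputable def shift {R : Type*} [CommRing R] (Q : R[X]) :
    MvPolynomial (Fin 2) R →ₐ[R] MvPolynomial (Fin 2) R :=
  MvPolynomial.aeval ![MvPolynomial.X 0, MvPolynomial.X 1 + Q.aeval (MvPolynomial.X 0)]

section shift

variable {R : Type*} [CommRing R]

theorem shift_X_zero (Q : R[X]) : shift Q (MvPolynomial.X 0) = MvPolynomial.X 0 := by
  simp [shift]

theorem shift_X_one (Q : R[X]) :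
    shift Q (MvPolynomial.X 1) = MvPolynomial.X 1 + Q.aeval (MvPolynomial.X 0) := by
  simp [shift]

theorem shift_aeval_X_zero (Q P : R[X]) :
    shift Q (P.aeval (MvPolynomial.X 0)) = P.aeval (MvPolynomial.X 0) := by
  rw [← Polynomial.aeval_algHom_apply, shift_X_zero]

theorem shift_neg_shift (Q : R[X]) (f : MvPolynomial (Fin 2) R) :
    shift (-Q) (shift Q f) = f := by
  have h : (shift (-Q)).comp (shift Q) = AlgHom.id R _ := by
    refine MvPolynomial.algHom_ext fun i => ?_
    fin_cases i
    · simp [shift_X_zero]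
    · simp [shift_X_one, shift_aeval_X_zero]
  exact DFunLike.congr_fun h f

theorem shift_shift_neg (Q : R[X]) (f : MvPolynomial (Fin 2) R) :
    shift Q (shift (-Q) f) = f := by
  simpa using shift_neg_shift (-Q) f

theorem shift_injective (Q : R[X]) : Function.Injective (shift Q) :=
  Function.LeftInverse.injective (shift_neg_shift Q)

theorem shift_surjective (Q : R[X]) : Function.Surjective (shift Q) :=
  fun f => ⟨shift (-Q) f, shift_shift_neg Q f⟩

/-- Compatibility with base change, needed to specialize the generic jet to the jet of a given
series. -/
theorem map_shift {S : Type*} [CommRing S] (φ : R →+* S) (Q : R[X])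
    (f : MvPolynomial (Fin 2) R) :
    MvPolynomial.map φ (shift Q f) = shift (Q.map φ) (MvPolynomial.map φ f) := by
  have h : (MvPolynomial.map φ).comp (shift Q).toRingHom =
      (shift (Q.map φ)).toRingHom.comp (MvPolynomial.map φ) := by
    refine MvPolynomial.ringHom_ext (fun r => ?_) fun i => ?_
    · simp [← MvPolynomial.algebraMap_eq]
    · fin_cases i
      · simp [shift_X_zero]
      · simp [shift_X_one, Polynomial.aeval_def, Polynomial.hom_eval₂, Polynomial.eval₂_map,
          MvPolynomial.algebraMap_eq, MvPolynomial.map_comp_C]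
  exact DFunLike.congr_fun h f

end shift

/-! ### The valuation as a least weight. -/

/-- The weight `i + T j` of the monomial `x ^ i y ^ j`. -/
def weight (T : ℕ) (s : Fin 2 →₀ ℕ) : ℕ := s 0 + T * s 1

/-- The substitution `f(x, y) ↦ f(x, x ^ T u(x))`. -/
noncomputable def monomialSubst (T : ℕ) (u : PowerSeries ℂ[X]) : PlaneRing →+* PowerSeries ℂ[X] :=
  MvPolynomial.eval₂Hom ((PowerSeries.C : ℂ[X] →+* PowerSeries ℂ[X]).comp Polynomial.C)
    ![PowerSeries.X, PowerSeries.X ^ T * u]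

theorem monomialSubst_apply (T : ℕ) (u : PowerSeries ℂ[X]) (g : PlaneRing) :
    monomialSubst T u g = ∑ s ∈ g.support,
      PowerSeries.X ^ weight T s * (PowerSeries.C (Polynomial.C (g.coeff s)) * u ^ s 1) := by
  rw [monomialSubst, MvPolynomial.coe_eval₂Hom, MvPolynomial.eval₂_eq']
  refine Finset.sum_congr rfl fun s _ => ?_
  simp [weight, Fin.prod_univ_two, pow_add, pow_mul, mul_pow]
  ring

theorem coeff_monomialSubst_of_lt {T : ℕ} {u : PowerSeries ℂ[X]} {g : PlaneRing} {m : ℕ}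
    (h : ∀ s ∈ g.support, m < weight T s) : PowerSeries.coeff m (monomialSubst T u g) = 0 := by
  rw [monomialSubst_apply, map_sum]
  refine Finset.sum_eq_zero fun s hs => ?_
  rw [PowerSeries.coeff_X_pow_mul', if_neg (not_le.2 (h s hs))]

/-- No cancellation occurs in the lowest weight: monomials of equal weight are told apart by their
y-exponents, so the coefficient is a nonzero polynomial evaluated at θ + c. The transcendence of θ
enters here. -/
theorem coeff_monomialSubst_weight_ne_zero {T : ℕ} {u : PowerSeries ℂ[X]} {c : ℂ}
    (hu : PowerSeries.constantCoeff u = X + C c) {g : PlaneRing} {s : Fin 2 →₀ ℕ}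
    (hs : s ∈ g.support) (h : ∀ r ∈ g.support, weight T s ≤ weight T r) :
    PowerSeries.coeff (weight T s) (monomialSubst T u g) ≠ 0 := by
  have h1 : PowerSeries.coeff (weight T s) (monomialSubst T u g) =
      (∑ r ∈ g.support with weight T r = weight T s, C (g.coeff r) * X ^ r 1).comp (X + C c) := by
    rw [monomialSubst_apply, map_sum, Finset.sum_filter, Polynomial.sum_comp]
    refine Finset.sum_congr rfl fun r hr => ?_
    rw [PowerSeries.coeff_X_pow_mul']
    split_ifs with h2 h3 h3
    · simp [h3, hu]
    · exact absurd (le_antisymm h2 (h r hr)) h3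
    · exact absurd h3.le h2
    · simp
  rw [h1]
  intro h0
  -- Undo the translation by c and read off the coefficient of θ^(s 1), which only s contributes to.
  have h2 := congrArg (fun p : ℂ[X] => (p.comp (X - C c)).coeff (s 1)) h0
  simp only [Polynomial.comp_assoc, Polynomial.add_comp, Polynomial.X_comp, Polynomial.C_comp,
    sub_add_cancel, Polynomial.comp_X, Polynomial.finsetSum_coeff, Polynomial.coeff_C_mul_X_pow,
    Polynomial.zero_comp, Polynomial.coeff_zero] at h2
  rw [Finset.sum_eq_single s, if_pos rfl] at h2
  · exact MvPolynomial.mem_support_iff.1 hs h2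
  · intro r hr hrs
    refine if_neg fun h3 => hrs ?_
    have h4 := (Finset.mem_filter.1 hr).2
    unfold weight at h4
    rw [h3] at h4
    ext i
    fin_cases i
    · exact Nat.add_right_cancel h4
    · exact h3.symm
  · intro h3
    exact absurd (Finset.mem_filter (p := fun r => weight T r = weight T s).2 ⟨hs, rfl⟩) h3

theorem substHom_eq {ξ : PowerSeries ℂ} {T : ℕ} {Q : ℂ[X]} {r : PowerSeries ℂ}
    (hr : ξ = (Q : PowerSeries ℂ) + PowerSeries.X ^ T * r) (f : PlaneRing) :
    substHom ξ T f = HahnSeries.ofPowerSeries ℝ ℂ[X]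
      (monomialSubst T (PowerSeries.map C r + PowerSeries.C X) (shift Q f)) := by
  have h : substHom ξ T = ((HahnSeries.ofPowerSeries ℝ ℂ[X]).comp
      (monomialSubst T (PowerSeries.map C r + PowerSeries.C X))).comp (shift Q).toRingHom := by
    refine MvPolynomial.ringHom_ext (fun a => ?_) fun i => ?_
    · simp only [substHom, monomialSubst, RingHom.comp_apply, AlgHom.toRingHom_eq_coe,
        RingHom.coe_coe, MvPolynomial.algHom_C, MvPolynomial.algebraMap_eq,
        MvPolynomial.coe_eval₂Hom, MvPolynomial.eval₂_C, HahnSeries.ofPowerSeries_C]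
    · fin_cases i
      · simp [substHom, monomialSubst, shift_X_zero]
      · have hQ : monomialSubst T (PowerSeries.map C r + PowerSeries.C X)
            (Q.aeval (MvPolynomial.X 0)) = PowerSeries.map C (Q : PowerSeries ℂ) := by
          rw [Polynomial.aeval_def, Polynomial.hom_eval₂, ← Polynomial.polynomial_map_coe,
            ← Polynomial.eval₂_C_X_eq_coe, Polynomial.eval₂_map]
          congr 1
          · ext a : 1
            simp [monomialSubst, MvPolynomial.algebraMap_eq]
          · simp [monomialSubst]
        have h1 : monomialSubst T (PowerSeries.map C r + PowerSeries.C X) (MvPolynomial.X 1) =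
            PowerSeries.X ^ T * (PowerSeries.map C r + PowerSeries.C X) := by
          simp [monomialSubst]
        have h2 : substHom ξ T (MvPolynomial.X 1) =
            seriesToHahn ξ + HahnSeries.single (T : ℝ) X := by
          simp [substHom]
        have h3 : (HahnSeries.single (T : ℝ) X : HahnSeries ℝ ℂ[X]) =
            HahnSeries.ofPowerSeries ℝ ℂ[X] (PowerSeries.X ^ T * PowerSeries.C X) := by
          rw [map_mul, HahnSeries.ofPowerSeries_X_pow, HahnSeries.ofPowerSeries_C,
            HahnSeries.C_apply, HahnSeries.single_mul_single]
          simp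
        change substHom ξ T (MvPolynomial.X 1) = HahnSeries.ofPowerSeries ℝ ℂ[X]
          (monomialSubst T (PowerSeries.map C r + PowerSeries.C X) (shift Q (MvPolynomial.X 1)))
        rw [h2, shift_X_one, map_add, hQ, h1, h3, seriesToHahn, ← map_add]
        congr 1
        rw [hr]
        simp
        ring
  exact DFunLike.congr_fun h f

theorem orderTop_ofPowerSeries {F : PowerSeries ℂ[X]} {m : ℕ}
    (h : ∀ i < m, PowerSeries.coeff i F = 0) (hm : PowerSeries.coeff m F ≠ 0) :
    (HahnSeries.ofPowerSeries ℝ ℂ[X] F).orderTop = ((m : ℝ) : WithTop ℝ) := by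
  refine HahnSeries.orderTop_eq_of_le ?_ fun g hg => ?_
  · rwa [HahnSeries.mem_support, HahnSeries.ofPowerSeries_apply_coeff]
  · by_contra! hlt
    rw [HahnSeries.mem_support, HahnSeries.ofPowerSeries_apply] at hg
    refine hg (HahnSeries.embDomain_notin_image_support fun ⟨i, hi, hig⟩ => ?_)
    have : (i : ℝ) = g := hig
    subst this
    have hi' : PowerSeries.coeff i F ≠ 0 := hi
    exact hi' (h i (by exact_mod_cast hlt))

/-- The value of `f` is the least weight of a monomial of `f(x, y + Q(x))`, for each polynomial `Q`
that agrees with `ξ` up to order `T`. -/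
theorem exists_quasimonomial_eq_weight {ξ : PowerSeries ℂ} {T : ℕ} {Q : ℂ[X]}
    (hQ : ∀ i < T, Q.coeff i = PowerSeries.coeff i ξ) {f : PlaneRing} (hf : f ≠ 0) :
    ∃ s ∈ (shift Q f).support, (∀ r ∈ (shift Q f).support, weight T s ≤ weight T r) ∧
      quasimonomial ξ T f = ((weight T s : ℝ) : WithTop ℝ) := by
  obtain ⟨r, hr⟩ : PowerSeries.X ^ T ∣ ξ - (Q : PowerSeries ℂ) :=
    PowerSeries.X_pow_dvd_iff.2 fun i hi => by simp [hQ i hi]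
  have hr' : ξ = (Q : PowerSeries ℂ) + PowerSeries.X ^ T * r := by rw [← hr, add_sub_cancel]
  have hne : (shift Q f).support.Nonempty := by
    rw [MvPolynomial.support_nonempty]
    exact (map_ne_zero_iff _ (shift_injective Q)).2 hf
  obtain ⟨s, hs, hmin⟩ := Finset.exists_min_image _ (weight T) hne
  refine ⟨s, hs, hmin, ?_⟩
  change (substHom ξ T f).orderTop = _
  rw [substHom_eq hr']
  refine orderTop_ofPowerSeries (fun i hi => ?_) ?_
  · exact coeff_monomialSubst_of_lt fun r hr => hi.trans_le (hmin r hr)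
  · exact coeff_monomialSubst_weight_ne_zero (c := PowerSeries.coeff 0 r)
      (by rw [map_add, PowerSeries.constantCoeff_C, ← PowerSeries.coeff_zero_eq_constantCoeff_apply,
        PowerSeries.coeff_map, add_comm]) hs hmin

section

variable {ξ : PowerSeries ℂ} {T : ℕ} {Q : ℂ[X]}

theorem quasimonomial_le (hQ : ∀ i < T, Q.coeff i = PowerSeries.coeff i ξ) {f : PlaneRing}
    {s : Fin 2 →₀ ℕ} (hs : s ∈ (shift Q f).support) :
    quasimonomial ξ T f ≤ ((weight T s : ℝ) : WithTop ℝ) := by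
  have hf : f ≠ 0 := by
    rintro rfl
    simp at hs
  obtain ⟨r, -, hmin, hr⟩ := exists_quasimonomial_eq_weight hQ hf
  rw [hr]
  exact_mod_cast hmin s hs

theorem le_quasimonomial_iff (hQ : ∀ i < T, Q.coeff i = PowerSeries.coeff i ξ) {f : PlaneRing}
    {m : ℝ} : (m : WithTop ℝ) ≤ quasimonomial ξ T f ↔
      ∀ s ∈ (shift Q f).support, m ≤ weight T s := by
  refine ⟨fun h s hs => by exact_mod_cast h.trans (quasimonomial_le hQ hs), fun h => ?_⟩
  rcases eq_or_ne f 0 with rfl | hf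
  · simp
  · obtain ⟨r, hr, -, hv⟩ := exists_quasimonomial_eq_weight hQ hf
    rw [hv]
    exact_mod_cast h r hr

end

/-! ### Counting monomials of bounded weight; the volume. -/

theorem sum_range_tsub_mul_add (T M K : ℕ) :
    ∑ j ∈ Finset.range (K + 1), (M + T - T * j) =
      (M + T) + ∑ j ∈ Finset.range K, (M - T * j) := by
  rw [Finset.sum_range_succ', add_comm]
  congr 1
  refine Finset.sum_congr rfl fun j _ => ?_
  rw [mul_add, mul_one, Nat.add_sub_add_right]

/-- Replacing M by M + T adds exactly M + T both to the sum and to M²/(2T) + M/2, so the error is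
only incurred in the base range M < T. Terms with j ≥ M vanish, so any K ≥ M gives the full sum. -/
theorem sum_range_tsub_mul_bounds {T : ℕ} (hT : 1 ≤ T) (M K : ℕ) (hMK : M ≤ K) :
    (M : ℝ) ^ 2 / (2 * T) + M / 2 ≤ (∑ j ∈ Finset.range K, (M - T * j) : ℕ) ∧
      (∑ j ∈ Finset.range K, (M - T * j) : ℕ) ≤ (M : ℝ) ^ 2 / (2 * T) + M / 2 + T / 2 := by
  have hT0 : (0 : ℝ) < T := by exact_mod_cast hT
  induction K generalizing M with
  | zero =>
    obtain rfl : M = 0 := Nat.le_zero.1 hMK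
    simp only [CharP.cast_eq_zero, ne_eq, OfNat.ofNat_ne_zero, not_false_eq_true, zero_pow, zero_div,
      add_zero, Finset.range_zero, Finset.sum_empty, le_refl, zero_add, true_and]
    positivity
  | succ K ih =>
    rcases lt_or_ge M T with h | h
    · have hsum : ∑ j ∈ Finset.range (K + 1), (M - T * j) = M := by
        rw [Finset.sum_range_succ', Finset.sum_eq_zero, zero_add, mul_zero, Nat.sub_zero]
        intro j _
        exact Nat.sub_eq_zero_of_le (h.le.trans (Nat.le_mul_of_pos_right T j.succ_pos))
      have hM : (M : ℝ) < T := by exact_mod_cast h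
      have hM0 : (0 : ℝ) ≤ M := M.cast_nonneg
      have h1 : (M : ℝ) ^ 2 / (2 * T) ≤ M / 2 := by
        rw [div_le_div_iff₀ (by positivity) two_pos]
        nlinarith
      have h2 : 0 ≤ (M : ℝ) ^ 2 / (2 * T) := by positivity
      rw [hsum]
      constructor <;> linarith
    · obtain ⟨M, rfl⟩ := Nat.exists_eq_add_of_le' h
      rw [sum_range_tsub_mul_add]
      obtain ⟨h1, h2⟩ := ih M (by omega)
      have h3 : ((M + T : ℕ) : ℝ) ^ 2 / (2 * T) = (M : ℝ) ^ 2 / (2 * T) + M + T / 2 := by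
        push_cast
        field_simp
        ring
      rw [h3]
      push_cast at h1 h2 ⊢
      constructor <;> linarith

/-- The monomials of weight less than `M`. -/
noncomputable def monomialsBelow (T M : ℕ) : Finset (Fin 2 →₀ ℕ) :=
  ((Finset.range M).sigma fun j => Finset.range (M - T * j)).image
    fun p => Finsupp.equivFunOnFinite.symm ![p.2, p.1]

theorem mem_monomialsBelow {T : ℕ} (hT : 1 ≤ T) {M : ℕ} {s : Fin 2 →₀ ℕ} :
    s ∈ monomialsBelow T M ↔ weight T s < M := by
  simp only [monomialsBelow, Finset.mem_image, Finset.mem_sigma, Finset.mem_range, weight]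
  constructor
  · rintro ⟨⟨j, i⟩, ⟨-, h⟩, rfl⟩
    simp at h ⊢
    omega
  · intro h
    refine ⟨⟨s 1, s 0⟩, ⟨?_, by simp; omega⟩, ?_⟩
    · have := Nat.le_mul_of_pos_left (s 1) hT
      dsimp
      omega
    · ext i
      fin_cases i <;> rfl

theorem card_monomialsBelow (T M : ℕ) :
    (monomialsBelow T M).card = ∑ j ∈ Finset.range M, (M - T * j) := by
  rw [monomialsBelow, Finset.card_image_of_injective, Finset.card_sigma]
  · simp
  · rintro ⟨j, i⟩ ⟨j', i'⟩ h
    have h' := Finsupp.equivFunOnFinite.symm.injective h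
    have h0 := congrFun h' 0
    have h1 := congrFun h' 1
    simp at h0 h1
    subst h0 h1
    rfl

theorem le_card_monomialsBelow {T : ℕ} (hT : 1 ≤ T) (M : ℕ) :
    (M : ℝ) ^ 2 / (2 * T) + M / 2 ≤ (monomialsBelow T M).card := by
  rw [card_monomialsBelow]
  exact (sum_range_tsub_mul_bounds hT M M le_rfl).1

theorem card_monomialsBelow_le {T : ℕ} (hT : 1 ≤ T) (M : ℕ) :
    (monomialsBelow T M).card ≤ (M : ℝ) ^ 2 / (2 * T) + M / 2 + T / 2 := by
  rw [card_monomialsBelow]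
  exact (sum_range_tsub_mul_bounds hT M M le_rfl).2

/-- The coefficients of `f(x, y + Q(x))` at the monomials of weight less than `M`. -/
noncomputable def coeffsBelow (T M : ℕ) (Q : ℂ[X]) :
    PlaneRing →ₗ[ℂ] (monomialsBelow T M → ℂ) :=
  LinearMap.pi fun r => (MvPolynomial.lcoeff ℂ (r : Fin 2 →₀ ℕ)) ∘ₗ (shift Q).toLinearMap

theorem coeffsBelow_apply (T M : ℕ) (Q : ℂ[X]) (f : PlaneRing) (r : monomialsBelow T M) :
    coeffsBelow T M Q f r = (shift Q f).coeff r := rfl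

theorem coeffsBelow_surjective (T M : ℕ) (Q : ℂ[X]) :
    Function.Surjective (coeffsBelow T M Q) := by
  classical
  intro c
  obtain ⟨f, hf⟩ := shift_surjective Q (∑ s : monomialsBelow T M, MvPolynomial.monomial s (c s))
  refine ⟨f, funext fun r => ?_⟩
  rw [coeffsBelow_apply, hf, MvPolynomial.coeff_sum, Finset.sum_eq_single r]
  · simp
  · intro s _ hs
    rw [MvPolynomial.coeff_monomial, if_neg fun h => hs (Subtype.ext h)]
  · simp

/-- Weights are natural numbers, so being below m and being below `⌈m⌉₊` coincide; for m ≤ 0 both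
conditions are empty. -/
theorem coeffsBelow_eq_zero_iff {ξ : PowerSeries ℂ} {T : ℕ} (hT : 1 ≤ T) {Q : ℂ[X]}
    (hQ : ∀ i < T, Q.coeff i = PowerSeries.coeff i ξ) {m : ℝ} {f : PlaneRing} :
    coeffsBelow T ⌈m⌉₊ Q f = 0 ↔ (m : WithTop ℝ) ≤ quasimonomial ξ T f := by
  rw [le_quasimonomial_iff hQ]
  constructor
  · intro h s hs
    by_contra! hlt
    exact MvPolynomial.mem_support_iff.1 hs
      (congrFun h ⟨s, (mem_monomialsBelow hT).2 (Nat.lt_ceil.2 hlt)⟩)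
  · intro h
    funext r
    by_contra hr
    exact absurd (h r (MvPolynomial.mem_support_iff.2 hr))
      (not_le.2 (Nat.lt_ceil.1 ((mem_monomialsBelow hT).1 r.2)))

/-- The quotient by a valuation ideal has the monomials of smaller weight as a basis. -/
noncomputable def quotientValuationIdealEquiv (ξ : PowerSeries ℂ) {T : ℕ} (hT : 1 ≤ T) {Q : ℂ[X]}
    (hQ : ∀ i < T, Q.coeff i = PowerSeries.coeff i ξ) (m : ℝ) :
    (PlaneRing ⧸ valuationIdeal (quasimonomial ξ T) m) ≃ₗ[ℂ] (monomialsBelow T ⌈m⌉₊ → ℂ) :=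
  (Submodule.Quotient.restrictScalarsEquiv ℂ (valuationIdeal (quasimonomial ξ T) m)).symm ≪≫ₗ
    Submodule.quotEquivOfEq _ (LinearMap.ker (coeffsBelow T ⌈m⌉₊ Q)) (by
      ext f
      rw [Submodule.restrictScalars_mem, LinearMap.mem_ker, coeffsBelow_eq_zero_iff hT hQ,
        mem_valuationIdeal (quasimonomial_nonneg ξ T.cast_nonneg)]) ≪≫ₗ
    (coeffsBelow T ⌈m⌉₊ Q).quotKerEquivOfSurjective (coeffsBelow_surjective T _ Q)

theorem tendsto_card_monomialsBelow {T : ℕ} (hT : 1 ≤ T) :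
    Tendsto (fun m : ℝ => ((monomialsBelow T ⌈m⌉₊).card : ℝ) / (m ^ 2 / 2)) atTop
      (𝓝 (1 / (T : ℝ))) := by
  have hT0 : (0 : ℝ) < T := by exact_mod_cast hT
  have hinv : Tendsto (fun m : ℝ => m⁻¹) atTop (𝓝 0) := tendsto_inv_atTop_zero
  have hup : Tendsto (fun m : ℝ => 1 / (T : ℝ) + (2 / T + 1) * m⁻¹ + (1 / T + 1 + T) * m⁻¹ ^ 2)
      atTop (𝓝 (1 / (T : ℝ))) := by
    simpa using ((tendsto_const_nhds (x := 1 / (T : ℝ))).add (hinv.const_mul (2 / (T : ℝ) + 1))).add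
      ((hinv.pow 2).const_mul (1 / (T : ℝ) + 1 + T))
  refine tendsto_of_tendsto_of_tendsto_of_le_of_le' tendsto_const_nhds hup ?_ ?_
  · filter_upwards [eventually_gt_atTop 0] with m hm
    rw [le_div_iff₀ (by positivity)]
    have h1 := Nat.le_ceil m
    calc 1 / (T : ℝ) * (m ^ 2 / 2) = m ^ 2 / (2 * T) := by field_simp
      _ ≤ (⌈m⌉₊ : ℝ) ^ 2 / (2 * T) + ⌈m⌉₊ / 2 :=
        le_add_of_le_of_nonneg (by gcongr) (by positivity)
      _ ≤ _ := le_card_monomialsBelow hT _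
  · filter_upwards [eventually_gt_atTop 0] with m hm
    rw [div_le_iff₀ (by positivity)]
    have h1 := (Nat.ceil_lt_add_one hm.le).le
    calc ((monomialsBelow T ⌈m⌉₊).card : ℝ)
        ≤ (⌈m⌉₊ : ℝ) ^ 2 / (2 * T) + ⌈m⌉₊ / 2 + T / 2 := card_monomialsBelow_le hT _
      _ ≤ (m + 1) ^ 2 / (2 * T) + (m + 1) / 2 + T / 2 := by gcongr
      _ = _ := by
        field_simp
        ring

theorem isVolume_quasimonomial (ξ : PowerSeries ℂ) {T : ℕ} (hT : 1 ≤ T) :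
    IsVolume (quasimonomial ξ T) (1 / T) := by
  have hQ : ∀ i < T, (PowerSeries.trunc T ξ).coeff i = PowerSeries.coeff i ξ := fun i hi => by
    rw [PowerSeries.coeff_trunc, if_pos hi]
  refine ⟨fun m => Module.Finite.equiv (quotientValuationIdealEquiv ξ hT hQ m).symm, ?_⟩
  convert tendsto_card_monomialsBelow hT using 4 with m
  rw [(quotientValuationIdealEquiv ξ hT hQ m).finrank_eq]
  simp

/-! ### Polynomials of bounded degree and the matrix of the shift. -/

/-- The polynomial of degree less than `D` with the given coefficients. -/
noncomputable def ofCoeffs (D : ℕ) : (monomialsBelow 1 D → ℂ) →ₗ[ℂ] PlaneRing :=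
  Fintype.linearCombination ℂ fun s : monomialsBelow 1 D =>
    MvPolynomial.monomial (s : Fin 2 →₀ ℕ) (1 : ℂ)

theorem ofCoeffs_apply (D : ℕ) (c : monomialsBelow 1 D → ℂ) :
    ofCoeffs D c = ∑ s : monomialsBelow 1 D, MvPolynomial.monomial (s : Fin 2 →₀ ℕ) (c s) := by
  simp [ofCoeffs, Fintype.linearCombination_apply, MvPolynomial.smul_monomial]

theorem coeff_ofCoeffs (D : ℕ) (c : monomialsBelow 1 D → ℂ) (r : monomialsBelow 1 D) :
    (ofCoeffs D c).coeff r = c r := by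
  classical
  rw [ofCoeffs_apply, MvPolynomial.coeff_sum, Finset.sum_eq_single r]
  · simp
  · intro s _ hs
    rw [MvPolynomial.coeff_monomial, if_neg fun h => hs (Subtype.ext h)]
  · simp

theorem ofCoeffs_injective (D : ℕ) : Function.Injective (ofCoeffs D) := fun c c' h =>
  funext fun r => by rw [← coeff_ofCoeffs D c, h, coeff_ofCoeffs]

/-- For T = 1 the weight is the degree, so the same count also gives the dimension of the space of
polynomials of bounded degree. -/
theorem weight_one_eq_sum (s : Fin 2 →₀ ℕ) : weight 1 s = s.sum fun _ e => e := by
  rw [Finsupp.sum_fintype _ _ fun _ => rfl, Fin.sum_univ_two, weight, one_mul]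

theorem totalDegree_ofCoeffs_le (d : ℕ) (c : monomialsBelow 1 (d + 1) → ℂ) :
    (ofCoeffs (d + 1) c).totalDegree ≤ d := by
  rw [ofCoeffs_apply]
  refine MvPolynomial.totalDegree_finsetSum_le fun s _ => ?_
  refine (MvPolynomial.totalDegree_monomial_le _ _).trans ?_
  have h := (mem_monomialsBelow le_rfl).1 s.2
  rw [weight_one_eq_sum] at h
  exact Nat.lt_succ_iff.1 h

theorem exists_ofCoeffs_eq {d : ℕ} {f : PlaneRing} (hf : f.totalDegree ≤ d) :
    ∃ c, ofCoeffs (d + 1) c = f := by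
  refine ⟨fun s => f.coeff s, ?_⟩
  rw [ofCoeffs_apply, Finset.sum_coe_sort (monomialsBelow 1 (d + 1))
    (fun s => MvPolynomial.monomial s (f.coeff s))]
  conv_rhs => rw [← f.support_sum_monomial_coeff]
  symm
  refine Finset.sum_subset (fun s hs => ?_) fun s _ hs => ?_
  · rw [mem_monomialsBelow le_rfl, weight_one_eq_sum]
    exact Nat.lt_succ_iff.2 ((MvPolynomial.le_totalDegree hs).trans hf)
  · rw [MvPolynomial.notMem_support_iff.1 hs, map_zero]

/-- The coefficients of weight less than `M` of `f(x, y + Q(x))`, as linear functions of the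
coefficients of a polynomial `f` of degree less than `D`. -/
noncomputable def shiftMatrix {R : Type*} [CommRing R] (T M D : ℕ) (Q : R[X]) :
    Matrix (monomialsBelow T M) (monomialsBelow 1 D) R :=
  Matrix.of fun r s => (shift Q (MvPolynomial.monomial (s : Fin 2 →₀ ℕ) 1)).coeff r

theorem shiftMatrix_map {R S : Type*} [CommRing R] [CommRing S] (φ : R →+* S) (T M D : ℕ)
    (Q : R[X]) : (shiftMatrix T M D Q).map φ = shiftMatrix T M D (Q.map φ) := by
  ext r s
  simp only [shiftMatrix, Matrix.map_apply, Matrix.of_apply]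
  rw [← MvPolynomial.coeff_map, map_shift, MvPolynomial.map_monomial, map_one]

theorem shiftMatrix_mulVec (T M D : ℕ) (Q : ℂ[X]) (c : monomialsBelow 1 D → ℂ) :
    (shiftMatrix T M D Q).mulVec c = coeffsBelow T M Q (ofCoeffs D c) := by
  funext r
  rw [ofCoeffs, Fintype.linearCombination_apply, map_sum, Finset.sum_apply]
  simp only [map_smul, coeffsBelow_apply, MvPolynomial.coeff_smul, smul_eq_mul, Matrix.mulVec,
    dotProduct, shiftMatrix, Matrix.of_apply, mul_comm]

section

variable {ξ : PowerSeries ℂ} {T : ℕ} {Q : ℂ[X]}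

/-- There are fewer linear conditions than unknown coefficients. -/
theorem exists_le_quasimonomial (hT : 1 ≤ T) {M d : ℕ}
    (h : (monomialsBelow T M).card < (monomialsBelow 1 (d + 1)).card) :
    ∃ f : PlaneRing, f ≠ 0 ∧ f.totalDegree ≤ d ∧
      ((M : ℝ) : WithTop ℝ) ≤ quasimonomial ξ T f := by
  have hQ : ∀ i < T, (PowerSeries.trunc T ξ).coeff i = PowerSeries.coeff i ξ := fun i hi => by
    rw [PowerSeries.coeff_trunc, if_pos hi]
  have hker : LinearMap.ker (coeffsBelow T M (PowerSeries.trunc T ξ) ∘ₗ ofCoeffs (d + 1)) ≠ ⊥ :=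
    LinearMap.ker_ne_bot_of_finrank_lt (by simpa using h)
  obtain ⟨c, hc, hc0⟩ := Submodule.exists_mem_ne_zero_of_ne_bot hker
  refine ⟨ofCoeffs (d + 1) c, (map_ne_zero_iff _ (ofCoeffs_injective _)).2 hc0,
    totalDegree_ofCoeffs_le d c, (coeffsBelow_eq_zero_iff hT hQ).1 ?_⟩
  rwa [Nat.ceil_natCast]

/-- A kernel vector is a polynomial of value at least m + 1; as values are integers, its absence
means that all values are at most m. -/
theorem mulVec_shiftMatrix_injective_iff (hT : 1 ≤ T)
    (hQ : ∀ i < T, Q.coeff i = PowerSeries.coeff i ξ) (m d : ℕ) :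
    Function.Injective (shiftMatrix T (m + 1) (d + 1) Q).mulVec ↔
      ∀ f : PlaneRing, f ≠ 0 → f.totalDegree ≤ d →
        quasimonomial ξ T f ≤ ((m : ℝ) : WithTop ℝ) := by
  rw [← Matrix.coe_mulVecLin, ← LinearMap.ker_eq_bot, LinearMap.ker_eq_bot']
  simp only [Matrix.mulVecLin_apply, shiftMatrix_mulVec]
  constructor
  · intro h f hf hd
    obtain ⟨c, rfl⟩ := exists_ofCoeffs_eq hd
    by_contra! hlt
    refine hf ?_
    rw [h c, map_zero]
    funext r
    by_contra hr
    have h1 := quasimonomial_le hQ (MvPolynomial.mem_support_iff.2 hr)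
    have h2 : m < weight T r := by exact_mod_cast hlt.trans_le h1
    exact absurd ((mem_monomialsBelow hT).1 r.2) (not_lt.2 h2)
  · intro h c hc
    by_contra hc0
    have h1 := h _ ((map_ne_zero_iff _ (ofCoeffs_injective _)).2 hc0) (totalDegree_ofCoeffs_le d c)
    have h2 := (coeffsBelow_eq_zero_iff (m := ((m + 1 : ℕ) : ℝ)) hT hQ).1
      (by rwa [Nat.ceil_natCast])
    have h3 : m + 1 ≤ m := by exact_mod_cast h2.trans h1
    exact absurd h3 (Nat.not_succ_le_self m)

end

/-! ### The special series x^n. -/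

section curve

variable {n : ℕ}

/-- Modulo y - x^n, every f is congruent to f(x, x^n). -/
theorem X_one_sub_X_zero_pow_dvd {f : PlaneRing}
    (hf : MvPolynomial.aeval ![(X : ℂ[X]), X ^ n] f = 0) :
    (MvPolynomial.X 1 - MvPolynomial.X 0 ^ n : PlaneRing) ∣ f := by
  rw [← Ideal.mem_span_singleton, ← Ideal.Quotient.eq_zero_iff_mem]
  set I : Ideal PlaneRing := Ideal.span {MvPolynomial.X 1 - MvPolynomial.X 0 ^ n}
  have h : Ideal.Quotient.mkₐ ℂ I =
      ((Ideal.Quotient.mkₐ ℂ I).comp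
        (Polynomial.aeval (MvPolynomial.X 0 : PlaneRing) : ℂ[X] →ₐ[ℂ] PlaneRing)).comp
          (MvPolynomial.aeval ![(X : ℂ[X]), X ^ n]) := by
    refine MvPolynomial.algHom_ext fun i => ?_
    fin_cases i
    · simp
    · simp only [AlgHom.comp_apply, MvPolynomial.aeval_X]
      simp only [Fin.mk_one, Matrix.cons_val_one, Matrix.cons_val_fin_one, map_pow,
        Polynomial.aeval_X]
      rw [← map_pow]
      exact Ideal.Quotient.eq.2 (Ideal.mem_span_singleton_self _)
  have h1 := DFunLike.congr_fun h f
  rw [AlgHom.comp_apply, hf, map_zero] at h1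
  exact h1

/-- A substitute for Bézout: the pure powers of x in f(x, y + x^n) form f(x, x^n), whose leading
monomial is the one chosen. -/
theorem exists_mem_support_shift_X_pow {f : PlaneRing}
    (hf : MvPolynomial.aeval ![(X : ℂ[X]), X ^ n] f ≠ 0) :
    ∃ s ∈ (shift (X ^ n) f).support, s 0 ≤ f.totalDegree * max 1 n ∧ s 1 = 0 := by
  set p := MvPolynomial.aeval ![(X : ℂ[X]), X ^ n] f with hp
  have h : (MvPolynomial.aeval ![(X : ℂ[X]), 0] : PlaneRing →ₐ[ℂ] ℂ[X]).comp (shift (X ^ n)) =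
      MvPolynomial.aeval ![(X : ℂ[X]), X ^ n] := by
    refine MvPolynomial.algHom_ext fun i => ?_
    fin_cases i
    · simp [shift_X_zero]
    · simp [shift_X_one]
  have h1 : p = MvPolynomial.aeval ![(X : ℂ[X]), 0] (shift (X ^ n) f) :=
    (DFunLike.congr_fun h f).symm
  rw [MvPolynomial.aeval_def, MvPolynomial.eval₂_eq'] at h1
  have h2 : p.coeff p.natDegree ≠ 0 := Polynomial.leadingCoeff_ne_zero.2 hf
  conv at h2 => enter [1, 1]; rw [h1]
  rw [Polynomial.finsetSum_coeff] at h2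
  obtain ⟨s, hs, hs0⟩ := Finset.exists_ne_zero_of_sum_ne_zero h2
  have hs1 : s 1 = 0 := by
    by_contra h3
    simp [Fin.prod_univ_two, zero_pow h3] at hs0
  refine ⟨s, hs, ?_, hs1⟩
  have h3 : p.natDegree = s 0 := by
    by_contra h4
    simp [Fin.prod_univ_two, hs1, Polynomial.coeff_X_pow, h4] at hs0
  rw [← h3]
  refine MvPolynomial.aeval_natDegree_le f le_rfl _ fun i => ?_
  fin_cases i <;> simp

theorem le_totalDegree_X_one_sub_X_zero_pow (n : ℕ) :
    n ≤ (MvPolynomial.X 1 - MvPolynomial.X 0 ^ n : PlaneRing).totalDegree := by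
  have h : (MvPolynomial.X 1 - MvPolynomial.X 0 ^ n : PlaneRing).coeff (Finsupp.single 0 n) ≠ 0 := by
    rw [MvPolynomial.coeff_sub, MvPolynomial.coeff_X_pow, if_pos rfl, MvPolynomial.coeff_X,
      if_neg]
    · simp
    · intro h
      simpa using DFunLike.congr_fun h 1
  simpa using MvPolynomial.le_totalDegree (MvPolynomial.mem_support_iff.2 h)

/-- The curve `y = x ^ n` meets a curve of degree `d` at the origin with multiplicity at most `n d`,
and its own value is `n ^ 2`. -/
theorem quasimonomial_X_pow_le (hn : 1 ≤ n) {f : PlaneRing} (hf : f ≠ 0) :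
    quasimonomial (PowerSeries.X ^ n) (n ^ 2 : ℕ) f ≤
      ((n * f.totalDegree : ℕ) : ℝ) := by
  have hQ : ∀ i < n ^ 2, (X ^ n : ℂ[X]).coeff i = PowerSeries.coeff i (PowerSeries.X ^ n) :=
    fun i _ => by rw [Polynomial.coeff_X_pow, PowerSeries.coeff_X_pow]
  induction hd : f.totalDegree using Nat.strong_induction_on generalizing f with
  | _ d ih =>
    -- Either the curve y = x^n is a component of f, and is split off by induction, or f restricts
    -- to a nonzero polynomial on it.
    by_cases hp : MvPolynomial.aeval ![(X : ℂ[X]), X ^ n] f = 0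
    · obtain ⟨g, rfl⟩ := X_one_sub_X_zero_pow_dvd hp
      have hg := right_ne_zero_of_mul hf
      rw [MvPolynomial.totalDegree_mul_of_isDomain (left_ne_zero_of_mul hf) hg] at hd
      have hdeg := le_totalDegree_X_one_sub_X_zero_pow n
      have h1 := ih g.totalDegree (by omega) hg rfl
      have h2 : quasimonomial (PowerSeries.X ^ n) (n ^ 2 : ℕ)
          (MvPolynomial.X 1 - MvPolynomial.X 0 ^ n) ≤ (((n ^ 2 : ℕ) : ℝ) : WithTop ℝ) := by
        -- The shift turns y - x^n into y, of weight n².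
        refine (quasimonomial_le hQ (s := Finsupp.single 1 1) ?_).trans_eq ?_
        · rw [map_sub, map_pow, shift_X_zero, shift_X_one, map_pow, Polynomial.aeval_X,
            add_sub_cancel_right, MvPolynomial.mem_support_iff]
          simp
        · simp [weight]
      rw [AddValuation.map_mul]
      refine (add_le_add h2 h1).trans ?_
      -- The factor y - x^n has value at most n² and degree at least n, so it respects the slope n;
      -- this is where t = n² matters.
      have h3 : n ^ 2 + n * g.totalDegree ≤ n * d := by
        rw [sq, ← mul_add]
        exact Nat.mul_le_mul_left n (by omega)
      exact_mod_cast h3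
    · obtain ⟨s, hs, hs0, hs1⟩ := exists_mem_support_shift_X_pow hp
      refine (quasimonomial_le hQ hs).trans ?_
      rw [max_eq_right hn, hd, mul_comm] at hs0
      rw [weight, hs1, mul_zero, add_zero]
      exact_mod_cast hs0

end curve

/-! ### Passing from one series to very general series. -/

/-- The generic polynomial of degree less than `k` with zero constant term. -/
noncomputable def genericJet (k : ℕ) : (MvPolynomial (Fin (k - 1)) ℂ)[X] :=
  ∑ i : Fin (k - 1), C (MvPolynomial.X i) * X ^ (i + 1 : ℕ)

theorem coeff_map_genericJet {k : ℕ} {ξ : PowerSeries ℂ} (hξ : PowerSeries.constantCoeff ξ = 0)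
    (j : ℕ) (hj : j < k) :
    ((genericJet k).map (MvPolynomial.aeval (jet k ξ)).toRingHom).coeff j =
      PowerSeries.coeff j ξ := by
  rw [Polynomial.coeff_map, genericJet, Polynomial.finsetSum_coeff, map_sum]
  simp only [Polynomial.coeff_C_mul_X_pow]
  cases j with
  | zero => simp [hξ]
  | succ j =>
    rw [Finset.sum_eq_single ⟨j, by omega⟩]
    · simp [jet]
    · intro i _ hi
      rw [if_neg, map_zero]
      intro h
      exact hi (Fin.ext (by simpa using h.symm))
    · simp

/-- If the bound `v(f) ≤ m` for polynomials of degree at most `d` holds for one series, then it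
holds for all series with jets outside a proper closed subset. -/
theorem exists_isProperZariskiClosed {T : ℕ} (hT : 1 ≤ T) (m d : ℕ) {ξ₀ : PowerSeries ℂ}
    (hξ₀ : PowerSeries.constantCoeff ξ₀ = 0)
    (h₀ : ∀ f : PlaneRing, f ≠ 0 → f.totalDegree ≤ d →
      quasimonomial ξ₀ T f ≤ ((m : ℝ) : WithTop ℝ)) :
    ∃ Z : Set (Fin (T - 1) → ℂ), IsProperZariskiClosed Z ∧
      ∀ ξ : PowerSeries ℂ, PowerSeries.constantCoeff ξ = 0 → jet T ξ ∉ Z →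
        ∀ f : PlaneRing, f ≠ 0 → f.totalDegree ≤ d →
          quasimonomial ξ T f ≤ ((m : ℝ) : WithTop ℝ) := by
  classical
  let A (a : Fin (T - 1) → ℂ) := shiftMatrix T (m + 1) (d + 1)
    ((genericJet T).map (MvPolynomial.aeval a).toRingHom)
  have hA₀ : Function.Injective (A (jet T ξ₀)).mulVec :=
    (mulVec_shiftMatrix_injective_iff hT (coeff_map_genericJet hξ₀) m d).2 h₀
  -- A left inverse B at ξ₀ replaces the choice of a maximal minor: det(B · A(a)) is polynomial in
  -- the jet a, equals 1 at ξ₀, and forces A(a) to be injective wherever it is nonzero.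
  obtain ⟨g, hg⟩ := LinearMap.exists_leftInverse_of_injective (Matrix.toLin' (A (jet T ξ₀)))
    (LinearMap.ker_eq_bot.2 hA₀)
  let B := LinearMap.toMatrix' g
  have hB : B * A (jet T ξ₀) = 1 := by
    rw [← LinearMap.toMatrix'_id, ← hg, LinearMap.toMatrix'_comp, LinearMap.toMatrix'_toLin']
  let B' : Matrix (monomialsBelow 1 (d + 1)) (monomialsBelow T (m + 1))
    (MvPolynomial (Fin (T - 1)) ℂ) := B.map MvPolynomial.C
  let p : MvPolynomial (Fin (T - 1)) ℂ := (B' *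
    shiftMatrix T (m + 1) (d + 1) (genericJet T)).det
  have hp (a : Fin (T - 1) → ℂ) : MvPolynomial.aeval a p = (B * A a).det := by
    change (MvPolynomial.aeval a).toRingHom p = _
    rw [RingHom.map_det, RingHom.mapMatrix_apply, Matrix.map_mul, shiftMatrix_map]
    congr 2
    ext i j
    simp [B']
  refine ⟨MvPolynomial.zeroLocus ℂ (Ideal.span {p}), ⟨⟨_, rfl⟩, fun h => ?_⟩, fun ξ hξ hZ => ?_⟩
  · have h1 : jet T ξ₀ ∈ MvPolynomial.zeroLocus ℂ (Ideal.span {p}) := h ▸ Set.mem_univ _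
    rw [MvPolynomial.zeroLocus_span] at h1
    have h2 := h1 p rfl
    rw [hp, hB, Matrix.det_one] at h2
    exact one_ne_zero h2
  · rw [← mulVec_shiftMatrix_injective_iff hT (coeff_map_genericJet hξ) m d]
    have h1 : (B * A (jet T ξ)).det ≠ 0 := by
      rw [← hp]
      intro h0
      refine hZ ?_
      rw [MvPolynomial.zeroLocus_span]
      rintro q rfl
      exact h0
    have h2 := Matrix.mulVec_injective_iff_isUnit.2
      ((Matrix.isUnit_iff_isUnit_det _).2 (isUnit_iff_ne_zero.2 h1))
    intro c c' hc
    refine h2 ?_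
    rw [← Matrix.mulVec_mulVec, ← Matrix.mulVec_mulVec]
    exact congrArg _ hc

/-! ### Bounds for μ_d and the limit. -/

section limit

variable {n : ℕ} {ξ : PowerSeries ℂ}

/-- Both counts have leading term e²/2; the n extra degrees absorb the lower-order terms ne/2 + n²/2
on the left. -/
theorem card_monomialsBelow_sq_lt (hn : 1 ≤ n) (e : ℕ) :
    (monomialsBelow (n ^ 2) (n * e)).card < (monomialsBelow 1 (n + e + 1)).card := by
  have h1 := card_monomialsBelow_le (Nat.one_le_pow 2 n hn) (n * e)
  have h2 := le_card_monomialsBelow le_rfl (n + e + 1)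
  have hn0 : (0 : ℝ) < n := by exact_mod_cast hn
  have he : (0 : ℝ) ≤ e := e.cast_nonneg
  have h3 : ((n * e : ℕ) : ℝ) ^ 2 / (2 * (n ^ 2 : ℕ)) = (e : ℝ) ^ 2 / 2 := by
    push_cast
    field_simp
  rw [h3] at h1
  push_cast at h1 h2
  have h4 : ((monomialsBelow (n ^ 2) (n * e)).card : ℝ) <
      (monomialsBelow 1 (n + e + 1)).card := by
    nlinarith [mul_nonneg hn0.le he]
  exact_mod_cast h4

theorem le_of_isMu (hn : 1 ≤ n) {d : ℕ} {m : ℝ}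
    (h : IsMu (quasimonomial ξ (n ^ 2 : ℕ)) d m) : (n : ℝ) * (d - n) ≤ m := by
  have hm : ∀ f : PlaneRing, f ≠ 0 → f.totalDegree ≤ d →
      quasimonomial ξ (n ^ 2 : ℕ) f ≤ (m : WithTop ℝ) := fun f hf hd => h.2 ⟨f, hf, hd, rfl⟩
  rcases lt_or_ge d n with hdn | hdn
  -- For d < n the bound is not positive, and the constant 1 has value 0.
  · have h1 := hm 1 one_ne_zero (by simp)
    rw [AddValuation.map_one] at h1
    have h2 : (0 : ℝ) ≤ m := by exact_mod_cast h1
    have h3 : (d : ℝ) < n := by exact_mod_cast hdn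
    nlinarith [(n.cast_nonneg : (0 : ℝ) ≤ n)]
  · obtain ⟨e, rfl⟩ := Nat.exists_eq_add_of_le hdn
    obtain ⟨f, hf, hd, hv⟩ := exists_le_quasimonomial (ξ := ξ) (Nat.one_le_pow 2 n hn)
      (card_monomialsBelow_sq_lt hn e)
    have h1 : ((n * e : ℕ) : ℝ) ≤ m := by exact_mod_cast hv.trans (hm f hf hd)
    push_cast at h1 ⊢
    linarith

theorem tendsto_mul_sub_div (n : ℕ) :
    Tendsto (fun d : ℕ => (n : ℝ) * (d - n) / d) atTop (𝓝 n) := by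
  have h : Tendsto (fun d : ℕ => (n : ℝ) - n ^ 2 * (d : ℝ)⁻¹) atTop (𝓝 (n - n ^ 2 * 0)) :=
    tendsto_const_nhds.sub (tendsto_inv_atTop_nhds_zero_nat.const_mul _)
  rw [mul_zero, sub_zero] at h
  refine h.congr' ?_
  filter_upwards [eventually_gt_atTop 0] with d hd
  have : (d : ℝ) ≠ 0 := by exact_mod_cast hd.ne'
  field_simp

theorem le_of_isMuHat (hn : 1 ≤ n) {s : ℝ} (h : IsMuHat (quasimonomial ξ (n ^ 2 : ℕ)) s) :
    (n : ℝ) ≤ s := by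
  obtain ⟨μ, hμ, hs⟩ := h
  exact le_of_tendsto_of_tendsto' (tendsto_mul_sub_div n) hs fun d =>
    div_le_div_of_nonneg_right (le_of_isMu hn (hμ d)) d.cast_nonneg

/-- The maximum is attained because values of nonzero polynomials are natural numbers, bounded here
by m. -/
theorem exists_isMu_le {T m d : ℕ} (h : ∀ f : PlaneRing, f ≠ 0 → f.totalDegree ≤ d →
    quasimonomial ξ T f ≤ ((m : ℝ) : WithTop ℝ)) :
    ∃ r : ℝ, IsMu (quasimonomial ξ T) d r ∧ r ≤ m := by
  let S : Set ℕ := {k | ∃ f : PlaneRing, f ≠ 0 ∧ f.totalDegree ≤ d ∧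
    quasimonomial ξ T f = ((k : ℝ) : WithTop ℝ)}
  have hS : S.Nonempty := ⟨0, 1, one_ne_zero, by simp, by simp⟩
  have hSm : m ∈ upperBounds S := by
    rintro k ⟨f, hf, hd, hk⟩
    have := h f hf hd
    rw [hk] at this
    exact_mod_cast this
  have hmem := Nat.sSup_mem hS ⟨m, hSm⟩
  refine ⟨(sSup S : ℕ), ⟨hmem, ?_⟩, by exact_mod_cast hSm hmem⟩
  rintro w ⟨f, hf, hd, rfl⟩
  have hQ : ∀ i < T, (PowerSeries.trunc T ξ).coeff i = PowerSeries.coeff i ξ := fun i hi => by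
    rw [PowerSeries.coeff_trunc, if_pos hi]
  obtain ⟨s, -, -, hs⟩ := exists_quasimonomial_eq_weight hQ hf
  rw [hs]
  exact_mod_cast le_csSup ⟨m, hSm⟩ (show weight T s ∈ S from ⟨f, hf, hd, hs⟩)

theorem isMuHat_of_forall_le (hn : 1 ≤ n) (h : ∀ d, ∀ f : PlaneRing, f ≠ 0 → f.totalDegree ≤ d →
    quasimonomial ξ (n ^ 2 : ℕ) f ≤ ((n * d : ℕ) : ℝ)) :
    IsMuHat (quasimonomial ξ (n ^ 2 : ℕ)) n := by
  choose μ hμ hle using fun d => exists_isMu_le (h d)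
  refine ⟨μ, hμ, tendsto_of_tendsto_of_tendsto_of_le_of_le' (tendsto_mul_sub_div n)
    tendsto_const_nhds (Eventually.of_forall fun d =>
      div_le_div_of_nonneg_right (le_of_isMu hn (hμ d)) d.cast_nonneg) ?_⟩
  filter_upwards [eventually_gt_atTop 0] with d hd
  rw [div_le_iff₀ (by exact_mod_cast hd)]
  exact_mod_cast hle d

theorem forVeryGeneral_isMuHat (hn : 1 ≤ n) :
    ForVeryGeneral (n ^ 2 : ℕ) fun ξ => IsMuHat (quasimonomial ξ (n ^ 2 : ℕ)) n := by
  have h0 : PowerSeries.constantCoeff (PowerSeries.X ^ n : PowerSeries ℂ) = 0 := by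
    simp [Nat.one_le_iff_ne_zero.1 hn]
  choose Z hZ hZ' using fun d => exists_isProperZariskiClosed (Nat.one_le_pow 2 n hn) (n * d) d h0
    fun f hf hd => (quasimonomial_X_pow_le hn hf).trans
      (by exact_mod_cast Nat.mul_le_mul_left n hd)
  rw [ForVeryGeneral, Nat.ceil_natCast]
  exact ⟨Z, hZ, fun ξ hξ hjet => isMuHat_of_forall_le hn fun d => hZ' d ξ hξ (hjet d)⟩

end limit

end QuasimonomialValuation

theorem mainTheorem8 (t : ℝ) (ht : 1 ≤ t) (hsq : ∃ a : ℤ, t = (a : ℝ) ^ 2) :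
    QuasimonomialValuation.ForVeryGeneral t (fun ξ =>
        QuasimonomialValuation.IsMinimal (QuasimonomialValuation.quasimonomial ξ t)) ∧
      QuasimonomialValuation.IsGenericMuHat t (√t) := by
  open QuasimonomialValuation in
  obtain ⟨n, rfl⟩ : ∃ n : ℕ, t = (n ^ 2 : ℕ) := by
    obtain ⟨a, rfl⟩ := hsq
    exact ⟨a.natAbs, by rw [← Int.cast_natCast, Nat.cast_pow, Int.natAbs_sq, Int.cast_pow]⟩
  have hn2 : 1 ≤ n ^ 2 := by exact_mod_cast ht
  have hn : 1 ≤ n := Nat.one_le_iff_ne_zero.2 fun h => by simp [h] at hn2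
  have hsqrt : √((n ^ 2 : ℕ) : ℝ) = n := by
    rw [Nat.cast_pow, Real.sqrt_sq n.cast_nonneg]
  -- The same exceptional sets serve both claims, as the volume is 1/n² for every ξ.
  obtain ⟨Z, hZ, h⟩ := forVeryGeneral_isMuHat hn
  refine ⟨⟨Z, hZ, fun ξ hξ hjet => ⟨n, 1 / (n ^ 2 : ℕ), h ξ hξ hjet,
    isVolume_quasimonomial ξ hn2, ?_, ?_⟩⟩, ?_, fun ξ _ s hs => ?_⟩
  · have : (0 : ℝ) < (n ^ 2 : ℕ) := by exact_mod_cast hn2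
    positivity
  · rw [one_div_one_div, hsqrt]
  · rw [hsqrt]
    exact ⟨Z, hZ, h⟩
  · rw [hsqrt]
    exact le_of_isMuHat hn hs
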